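/- Let $d\ge 1$ and let $\vec\mu=(\mu_1,\dots,\mu_d)$ be finite positive Borel measures on $\mathbb R$, none of which has finite support. Let $\Delta_j$ be the convex hull of $\operatorname{supp}\mu_j$, and assume that $\vec\mu$ is an Angelesco system: each $\Delta_j$ is a closed bounded segment and $\Delta_i\cap\Delta_j=\varnothing$ for $i\ne j$. Let $\Delta_{\max}$ be the convex hull of $\bigcup_j\Delta_j$, let $|\Delta|$ denote the length of a segment $\Delta$, and, if $d\ge 2$, let $g_{\min}=\min_{i\neq j}\operatorname{dist}(\Delta_i,\Delta_j)>0$ be the smallest gap. For $\vec n\in\mathbb Z_+^d$ put $|\vec n|=n_1+\dots+n_d$, and call a real polynomial $P$ of degree at most $|\vec n|$ a type II polynomial of index $\vec n$ if $\int P(x)x^l\,d\mu_j(x)=0$ for all $j$ and all $0\le l<n_j$. Then the following hold. (A) $\vec\mu$ is perfect: for every $\vec n\in\mathbb Z_+^d$ there is a type II polynomial $P_{\vec n}(x)=x^{|\vec n|}+\cdots$ of index $\vec n$, and every type II polynomial of index $\vec n$ is a constant multiple of it. Moreover, there are unique real numbers $a_{\vec n,j},b_{\vec n,j}$ ($\vec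 n\in\mathbb Z_+^d$, $1\le j\le d$), the nearest-neighbour recurrence coefficients, such that $$xP_{\vec n}(x)=P_{\vec n+\vec e_j}(x)+b_{\vec n,j}P_{\vec n}(x)+\sum_{l=1}^d a_{\vec n,l}P_{\vec n-\vec e_l}(x)$$ for all $\vec n\in\mathbb Z_+^d$ and all $j\in\{1,\dots,d\}$, where $\vec e_1,\dots,\vec e_d$ is the standard basis and, whenever $n_l=0$, $a_{\vec n,l}=0$ and the term with $P_{\vec n-\vec e_l}$ is absent. They satisfy: (B) $a_{\vec n,j}>0$ whenever $n_j>0$. (C) $\sup_{\vec n,j}a_{\vec n,j}<\infty$ and $\sup_{\vec n,j}|b_{\vec n,j}|<\infty$, the suprema being over all $\vec n\in\mathbb Z_+^d$ and $j\in\{1,\dots,d\}$; more precisely, for all such $\vec n$ and $j$, $$a_{\vec n,j}\le\Big(\frac{|\Delta_{\max}|}{g_{\min}}\Big)^{d-1}\Big(\frac{|\Delta_j|}{2}\Big)^2,\qquad |b_{\vec n,j}|\le 7\sup_{x\in\Delta_{\max}}|x| ,$$ where for $d=1$ the factor $(|\Delta_{\max}|/g_{\min})^{0}$ is read as $1$.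 -/

import Mathlib

open MeasureTheory Polynomial

noncomputable section

/-- The multi-index with a `1` in position `j` and `0` elsewhere. -/
def unitIndex {d : ℕ} (j : Fin d) : Fin d → ℕ := Pi.single j 1

/-- The length `|n| = n₁ + ⋯ + n_d` of a multi-index. -/
def indexLength {d : ℕ} (n : Fin d → ℕ) : ℕ := ∑ j, n j

/-- `P` is a type II multiple orthogonal polynomial of index `n` (possibly `0`): its degree is at
most `|n|` and `∫ P(x) x^l dμ_j(x) = 0` for all `j` and all `l < n_j`. -/
def IsTypeII {d : ℕ} (μ : Fin d → Measure ℝ) (n : Fin d → ℕ) (P : ℝ[X]) : Prop :=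
  P.natDegree ≤ indexLength n ∧
    ∀ j : Fin d, ∀ l : ℕ, l < n j → ∫ x, P.eval x * x ^ l ∂(μ j) = 0

/-- `P` is a type II polynomial of index `n` in its standard normalization
`P(x) = x^|n| + ⋯`. -/
def IsMonicTypeII {d : ℕ} (μ : Fin d → Measure ℝ) (n : Fin d → ℕ) (P : ℝ[X]) : Prop :=
  IsTypeII μ n P ∧ P.Monic ∧ P.natDegree = indexLength n

/-- The multi-index `n` is normal: there is a type II polynomial of the form `x^|n| + ⋯`, and every
type II polynomial of index `n` is a constant multiple of it. -/
def IsNormalIndex {d : ℕ} (μ : Fin d → Measure ℝ) (n : Fin d → ℕ) : Prop :=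
  ∃ P : ℝ[X], IsMonicTypeII μ n P ∧ ∀ R : ℝ[X], IsTypeII μ n R → ∃ c : ℝ, R = C c * P

/-- The vector of measures is perfect: all multi-indices are normal. -/
def IsPerfect {d : ℕ} (μ : Fin d → Measure ℝ) : Prop :=
  ∀ n : Fin d → ℕ, IsNormalIndex μ n

/-- `a` and `b` are nearest-neighbour recurrence coefficients of `μ`: the monic type II polynomials
`P n` satisfy `x P_n = P_{n+e_j} + b_{n,j} P_n + ∑_l a_{n,l} P_{n-e_l}` for every `n` and every `j`.
When `n_l = 0` the index `n - e_l` does not exist; then `a_{n,l} = 0` and the term is absent (the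
truncated subtraction below plays no role, being multiplied by `0`). -/
def IsRecurrenceCoeff {d : ℕ} (μ : Fin d → Measure ℝ) (a b : (Fin d → ℕ) → Fin d → ℝ) : Prop :=
  ∃ P : (Fin d → ℕ) → ℝ[X],
    (∀ n, IsMonicTypeII μ n (P n)) ∧
    (∀ n l, n l = 0 → a n l = 0) ∧
    ∀ n j, X * P n =
      P (n + unitIndex j) + C (b n j) * P n + ∑ l, C (a n l) * P (n - unitIndex l)

/-- `Δ_j`, the convex hull of the support of `μ_j`. -/
def hullSupp {d : ℕ} (μ : Fin d → Measure ℝ) (j : Fin d) : Set ℝ :=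
  convexHull ℝ (μ j).support

/-- An Angelesco system: the convex hulls of the supports are closed bounded segments that are
pairwise disjoint. No ordering of the segments is imposed. -/
structure IsAngelesco {d : ℕ} (μ : Fin d → Measure ℝ) : Prop where
  isCompact_hull : ∀ j, IsCompact (hullSupp μ j)
  disjoint_hull : ∀ i j, i ≠ j → Disjoint (hullSupp μ i) (hullSupp μ j)

/-- `Δ_max`, the smallest interval that contains all the `Δ_j`. -/
def hullMax {d : ℕ} (μ : Fin d → Measure ℝ) : Set ℝ :=
  convexHull ℝ (⋃ j, hullSupp μ j)

/-- `g_min`, the smallest distance between two different segments `Δ_i`, `Δ_j`; for an Angelesco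
system this is the smallest of the lengths of the `d - 1` open intervals between neighbouring
segments. For `d = 1` there is no gap, and the value (which is `0`) is irrelevant. -/
def gapMin {d : ℕ} (μ : Fin d → Measure ℝ) : ℝ :=
  sInf {r : ℝ | ∃ i j, i ≠ j ∧ ∃ x ∈ hullSupp μ i, ∃ y ∈ hullSupp μ j, r = |x - y|}

end

/-! A polynomial orthogonal to all powers below `n j` on `Δ_j` changes sign at least `n j` times
there. The segments are disjoint, so a nonzero polynomial satisfying all the conditions has at least
`|n|` zeros. This gives normality, and places exactly `n j` simple zeros of `P_n` in each `Δ_j`.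

The same count, applied with a squared weight `(X - x) ^ 2`, shows that no nontrivial combination of
`P = P_{n+e_j}` and `Q = P_n` has a double zero. Hence the Wronskian `P' Q - P Q'` never vanishes
(`wronskian_eval_ne_zero`). Two consequences follow. Between two zeros of `P` in one segment lies a
zero of `Q`. The residues of `Q / P` share one sign and sum to `1`, so `b_{n,j}`, the sum of the
zeros of `P` weighted by these residues, is a convex combination of those zeros.

Comparing moments gives `a_{n,j} = h_n / h_{n-e_j}`, where `h_n = ∫ P_n x^{n_j} dμ_j`. Write `P_n =
p q`, with the zeros of `p` in `Δ_j` and those of `q` elsewhere. Then `h_n = ∫ p² q dμ_j`, and `q`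
has constant sign on `Δ_j`; the sign depends only on the `n_i` with `i ≠ j`, so the quotient is
positive. For the upper bound, `p` minimizes the weighted norm among monic polynomials of its
degree. The competitor is `(x - c) p'`, with `p'` the corresponding factor of `P_{n-e_j}` and `c`
the midpoint of `Δ_j`; interlacing compares the weights at the cost of one factor `|Δ_max| / g_min`
per other segment. -/

/-! ### Integrals of polynomials against a compactly supported measure -/

theorem ae_mem_convexHull_support (μ : Measure ℝ) :
    ∀ᵐ x ∂μ, x ∈ convexHull ℝ μ.support := by
  filter_upwards [μ.support_mem_ae] with x hx using subset_convexHull ℝ _ hx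

theorem integrable_eval_of_isCompact_hull (μ : Measure ℝ) [IsFiniteMeasure μ]
    (hK : IsCompact (convexHull ℝ μ.support)) (P : ℝ[X]) :
    Integrable (fun x => P.eval x) μ := by
  have h : IntegrableOn (fun x => P.eval x) (convexHull ℝ μ.support) μ :=
    P.continuous.continuousOn.integrableOn_compact hK
  rwa [IntegrableOn, Measure.restrict_eq_self_of_ae_mem (ae_mem_convexHull_support μ)] at h

theorem integral_eval_le_of_le_on_hull (μ : Measure ℝ) [IsFiniteMeasure μ]
    (hK : IsCompact (convexHull ℝ μ.support)) {P Q : ℝ[X]}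
    (h : ∀ x ∈ convexHull ℝ μ.support, P.eval x ≤ Q.eval x) :
    ∫ x, P.eval x ∂μ ≤ ∫ x, Q.eval x ∂μ := by
  apply integral_mono_ae (integrable_eval_of_isCompact_hull μ hK P)
    (integrable_eval_of_isCompact_hull μ hK Q)
  filter_upwards [ae_mem_convexHull_support μ] with x hx using h x hx

/-- A vanishing integral would put the support inside the closed zero set of `P`, which is finite.
-/
theorem integral_eval_pos_of_nonneg_on_hull (μ : Measure ℝ) [IsFiniteMeasure μ]
    (hK : IsCompact (convexHull ℝ μ.support)) (hinf : μ.support.Infinite) {P : ℝ[X]}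
    (hP : P ≠ 0) (h : ∀ x ∈ convexHull ℝ μ.support, 0 ≤ P.eval x) :
    0 < ∫ x, P.eval x ∂μ := by
  have hnn : 0 ≤ᵐ[μ] fun x => P.eval x := by
    filter_upwards [ae_mem_convexHull_support μ] with x hx using h x hx
  refine lt_of_le_of_ne (integral_nonneg_of_ae hnn) fun h0 => ?_
  have hz := (integral_eq_zero_iff_of_nonneg_ae hnn
    (integrable_eval_of_isCompact_hull μ hK P)).1 h0.symm
  have hcl : IsClosed {x : ℝ | P.eval x = 0} := isClosed_eq P.continuous continuous_const
  have hsub : μ.support ⊆ {x : ℝ | P.eval x = 0} :=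
    Measure.support_subset_of_isClosed hcl (by filter_upwards [hz] with x hx using hx)
  apply hinf
  refine (P.roots.toFinset.finite_toSet).subset fun x hx => ?_
  simpa [hP] using hsub hx

theorem integral_mul_eval_eq_zero (μ : Measure ℝ) [IsFiniteMeasure μ]
    (hK : IsCompact (convexHull ℝ μ.support)) {P q : ℝ[X]} {m : ℕ}
    (h : ∀ l < m, ∫ x, P.eval x * x ^ l ∂μ = 0) (hq : q.degree < m) :
    ∫ x, (P * q).eval x ∂μ = 0 := by
  have hi : ∀ l : ℕ, Integrable (fun x => P.eval x * x ^ l) μ := fun l =>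
    (integrable_eval_of_isCompact_hull μ hK (P * X ^ l)).congr (ae_of_all _ fun x => by simp)
  by_cases hq0 : q = 0
  · simp [hq0]
  have hd : q.natDegree < m := (natDegree_lt_iff_degree_lt hq0).2 hq
  have : ∀ x : ℝ, (P * q).eval x = ∑ l ∈ Finset.range m, q.coeff l * (P.eval x * x ^ l) := by
    intro x
    rw [eval_mul, eval_eq_sum_range' hd, Finset.mul_sum]
    exact Finset.sum_congr rfl fun l _ => by ring
  simp_rw [this]
  rw [integral_finsetSum _ fun l _ => (hi l).const_mul _]
  refine Finset.sum_eq_zero fun l hl => ?_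
  rw [integral_const_mul, h l (Finset.mem_range.1 hl), mul_zero]

/-! ### Sign changes and zeros -/

/-- `Z` is the set of zeros in `S` of odd multiplicity. The induction splits off one linear factor
at a time and toggles the membership of its root in `Z`. -/
theorem exists_dvd_prod_mul_const_sign {S : Set ℝ} (hS : S.OrdConnected) (P : ℝ[X]) (hP : P ≠ 0) :
    ∃ Z : Finset ℝ, (Z : Set ℝ) ⊆ S ∧ (∏ z ∈ Z, (X - C z)) ∣ P ∧
      ((∀ x ∈ S, 0 ≤ (P * ∏ z ∈ Z, (X - C z)).eval x) ∨
        ∀ x ∈ S, (P * ∏ z ∈ Z, (X - C z)).eval x ≤ 0) := by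
  induction hN : P.natDegree generalizing P with
  | zero =>
    rw [eq_C_of_natDegree_eq_zero hN]
    refine ⟨∅, by simp, by simp, ?_⟩
    rcases le_total 0 (P.coeff 0) with h | h
    · left; simpa using fun _ _ => h
    · right; simpa using fun _ _ => h
  | succ N ih =>
    by_cases hr : ∃ r ∈ S, P.eval r = 0
    · obtain ⟨r, hrS, hr0⟩ := hr
      obtain ⟨P₁, rfl⟩ := dvd_iff_isRoot.2 hr0
      have hP₁ : P₁ ≠ 0 := right_ne_zero_of_mul hP
      obtain ⟨Z, hZS, hZd, hsign⟩ := ih P₁ hP₁ (by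
        rw [natDegree_mul (X_sub_C_ne_zero r) hP₁, natDegree_X_sub_C] at hN; omega)
      by_cases hrZ : r ∈ Z
      · refine ⟨Z.erase r, fun x hx => hZS (Finset.mem_of_mem_erase hx), ?_, ?_⟩
        · rw [← Finset.mul_prod_erase Z _ hrZ] at hZd
          exact (dvd_of_mul_left_dvd hZd).mul_left _
        · have : (X - C r) * P₁ * ∏ z ∈ Z.erase r, (X - C z) = P₁ * ∏ z ∈ Z, (X - C z) := by
            rw [← Finset.mul_prod_erase Z _ hrZ]; ring
          rwa [this]
      · refine ⟨insert r Z, ?_, ?_, ?_⟩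
        · rw [Finset.coe_insert]; exact Set.insert_subset hrS hZS
        · rw [Finset.prod_insert hrZ]; exact mul_dvd_mul_left _ hZd
        · have : ∀ x, ((X - C r) * P₁ * ∏ z ∈ insert r Z, (X - C z)).eval x =
              (x - r) ^ 2 * (P₁ * ∏ z ∈ Z, (X - C z)).eval x := by
            intro x
            rw [Finset.prod_insert hrZ]
            simp only [eval_mul, eval_sub, eval_X, eval_C]; ring
          simp_rw [this]
          rcases hsign with h | h
          · left; exact fun x hx => mul_nonneg (sq_nonneg _) (h x hx)
          · right; exact fun x hx => mul_nonpos_of_nonneg_of_nonpos (sq_nonneg _) (h x hx)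
    · push Not at hr
      refine ⟨∅, by simp, by simp, ?_⟩
      simp only [Finset.prod_empty, mul_one]
      by_contra! hcon
      obtain ⟨⟨x, hx, hx0⟩, y, hy, hy0⟩ := hcon
      have := (hS.isPreconnected.image _ P.continuous.continuousOn).ordConnected.out
        (Set.mem_image_of_mem _ hx) (Set.mem_image_of_mem _ hy) ⟨hx0.le, hy0.le⟩
      obtain ⟨r, hrS, hr0⟩ := this
      exact hr r hrS hr0

theorem degree_prod_X_sub_C (Z : Finset ℝ) : (∏ z ∈ Z, (X - C z) : ℝ[X]).degree = (Z.card : WithBot ℕ) := by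
  rw [degree_prod]; simp

theorem natDegree_prod_X_sub_C (Z : Finset ℝ) : (∏ z ∈ Z, (X - C z) : ℝ[X]).natDegree = Z.card :=
  natDegree_eq_of_degree_eq_some (degree_prod_X_sub_C Z)

theorem monic_prod_X_sub_C_finset (Z : Finset ℝ) : (∏ z ∈ Z, (X - C z) : ℝ[X]).Monic :=
  monic_prod_of_monic _ _ fun z _ => monic_X_sub_C z

/-- With fewer than `m` sign changes, multiplying by their linear factors gives constant sign, yet
orthogonality makes the integral zero. The nonnegative factor `T` serves to discard a double zero
without counting it. -/
theorem exists_zeros_in_hull (μ : Measure ℝ) [IsFiniteMeasure μ]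
    (hK : IsCompact (convexHull ℝ μ.support)) (hinf : μ.support.Infinite) {T S : ℝ[X]}
    (hT : ∀ x, 0 ≤ T.eval x) (hTS : T * S ≠ 0) {m : ℕ}
    (h : ∀ l < m, ∫ x, (T * S).eval x * x ^ l ∂μ = 0) :
    ∃ Z : Finset ℝ, (Z : Set ℝ) ⊆ convexHull ℝ μ.support ∧ m ≤ Z.card ∧
      (∏ z ∈ Z, (X - C z)) ∣ S := by
  obtain ⟨Z, hZ, hd, hs⟩ := exists_dvd_prod_mul_const_sign
    (convex_convexHull ℝ μ.support).ordConnected S (right_ne_zero_of_mul hTS)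
  refine ⟨Z, hZ, ?_, hd⟩
  by_contra! hlt
  have h0 := integral_mul_eval_eq_zero μ hK h (q := ∏ z ∈ Z, (X - C z))
    (by rw [degree_prod_X_sub_C]; exact_mod_cast hlt)
  have hne : T * S * ∏ z ∈ Z, (X - C z) ≠ 0 :=
    mul_ne_zero hTS (monic_prod_X_sub_C_finset Z).ne_zero
  rcases hs with hs | hs
  · refine (integral_eval_pos_of_nonneg_on_hull μ hK hinf hne fun x hx => ?_).ne' h0
    rw [mul_assoc, eval_mul]
    exact mul_nonneg (hT x) (hs x hx)
  · refine (integral_eval_pos_of_nonneg_on_hull μ hK hinf (neg_ne_zero.2 hne) fun x hx => ?_).ne' ?_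
    · rw [eval_neg, mul_assoc, eval_mul]
      exact neg_nonneg.2 (mul_nonpos_of_nonneg_of_nonpos (hT x) (hs x hx))
    · simp only [eval_neg, integral_neg, h0, neg_zero]

/-! ### Consequences of a nonvanishing Wronskian -/

/-- Otherwise Rolle's theorem for `P / Q` would produce a zero of the Wronskian. -/
theorem exists_eval_eq_zero_between_of_wronskian_ne_zero {P Q : ℝ[X]}
    (hW : ∀ x, (derivative P * Q - P * derivative Q).eval x ≠ 0) {z z' : ℝ} (hzz : z < z')
    (hz : P.eval z = 0) (hz' : P.eval z' = 0) : ∃ w, z < w ∧ w < z' ∧ Q.eval w = 0 := by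
  by_contra! hcon
  have hQ : ∀ x, P.eval x = 0 → Q.eval x ≠ 0 := fun x hx h0 => hW x (by simp [hx, h0])
  have hQ' : ∀ x ∈ Set.Icc z z', Q.eval x ≠ 0 := by
    intro x hx
    rcases hx.1.eq_or_lt with rfl | h1
    · exact hQ _ hz
    rcases hx.2.eq_or_lt with rfl | h2
    · exact hQ _ hz'
    exact hcon x h1 h2
  obtain ⟨w, hw, hw0⟩ := exists_hasDerivAt_eq_zero (f := fun x => P.eval x / Q.eval x)
    (f' := fun x => ((derivative P).eval x * Q.eval x - P.eval x * (derivative Q).eval x) /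
      Q.eval x ^ 2) hzz (P.continuousOn.div Q.continuousOn hQ') (by simp [hz, hz'])
    fun x hx => (P.hasDerivAt x).div (Q.hasDerivAt x) (hQ' x ⟨hx.1.le, hx.2.le⟩)
  have h2 : Q.eval w ^ 2 ≠ 0 := pow_ne_zero _ (hQ' w ⟨hw.1.le, hw.2.le⟩)
  rw [div_eq_zero_iff, or_iff_left h2] at hw0
  exact hW w (by simpa using hw0)

/-- The weights `c z = Q(z) / P'(z)` are the residues of `Q / P`. Lagrange interpolation at `Z`
gives `∑ c z = 1` from the leading coefficient of `Q`, and `∑ c z * z` for the coefficient in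
question, because `X * Q - P` equals `X * Q` on `Z`. -/
theorem abs_coeff_X_mul_sub_prod_le {Z : Finset ℝ} {Q : ℝ[X]} {N : ℕ} {M : ℝ}
    (hZ : Z.card = N + 1) (hQ : Q.Monic) (hQN : Q.natDegree = N)
    (hW : ∀ x, (derivative (∏ z ∈ Z, (X - C z)) * Q -
      (∏ z ∈ Z, (X - C z)) * derivative Q).eval x ≠ 0) (hM : ∀ z ∈ Z, |z| ≤ M) :
    |(X * Q - ∏ z ∈ Z, (X - C z)).coeff N| ≤ M := by
  classical
  set P : ℝ[X] := ∏ z ∈ Z, (X - C z) with hP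
  set W : ℝ[X] := derivative P * Q - P * derivative Q with hWdef
  have hPz : ∀ z ∈ Z, P.eval z = 0 := fun z hz => by
    rw [hP, eval_prod]; exact Finset.prod_eq_zero hz (by simp)
  have hder : ∀ z ∈ Z, (derivative P).eval z = ∏ y ∈ Z.erase z, (z - y) := fun z hz => by
    have := Lagrange.eval_nodal_derivative_eval_node_eq (s := Z) (v := (id : ℝ → ℝ)) hz
    simpa [Lagrange.nodal_eq, eval_prod, hP] using this
  have hd0 : ∀ z ∈ Z, ∏ y ∈ Z.erase z, (z - y) ≠ 0 := fun z hz =>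
    Finset.prod_ne_zero_iff.2 fun y hy => sub_ne_zero.2 (Finset.ne_of_mem_erase hy).symm
  set c : ℝ → ℝ := fun z => Q.eval z / ∏ y ∈ Z.erase z, (z - y) with hc
  have hcW : ∀ z ∈ Z, c z = W.eval z / (∏ y ∈ Z.erase z, (z - y)) ^ 2 := fun z hz => by
    have := hd0 z hz
    simp only [hc, hWdef, eval_sub, eval_mul, hPz z hz, hder z hz]
    field_simp
    ring
  have hsum : ∑ z ∈ Z, c z = 1 := by
    have := Lagrange.coeff_eq_sum (s := Z) (v := (id : ℝ → ℝ)) Function.injective_id.injOn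
      (P := Q) (by rw [degree_eq_natDegree hQ.ne_zero, hQN, hZ]; exact_mod_cast N.lt_succ_self)
    rw [hZ, Nat.add_sub_cancel, ← hQN, hQ.coeff_natDegree] at this
    simpa [hc] using this.symm
  have hPm : P.Monic := monic_prod_X_sub_C_finset Z
  have hcoeff : (X * Q - P).coeff N = ∑ z ∈ Z, c z * z := by
    have hlt : (X * Q - P).degree < (Z.card : WithBot ℕ) := by
      have h1 : (X * Q).degree = P.degree := by
        rw [degree_mul, degree_X, degree_prod_X_sub_C, degree_eq_natDegree hQ.ne_zero, hQN, hZ]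
        push_cast; ring
      have := degree_sub_lt_left h1 (mul_ne_zero X_ne_zero hQ.ne_zero) (by
        rw [(monic_X.mul hQ).leadingCoeff, hPm.leadingCoeff])
      rwa [h1, degree_prod_X_sub_C] at this
    have := Lagrange.coeff_eq_sum (s := Z) (v := (id : ℝ → ℝ)) Function.injective_id.injOn hlt
    rw [hZ, Nat.add_sub_cancel] at this
    rw [this]
    refine Finset.sum_congr rfl fun z hz => ?_
    simp only [id, eval_sub, eval_mul, eval_X, hPz z hz, hc]
    ring
  -- `c z` has the sign of the Wronskian at `z`. A negative weight would coexist with a positive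
  -- one, as the sum is `1`, and the Wronskian would vanish in between.
  have hnn : ∀ z ∈ Z, 0 ≤ c z := by
    by_contra! hcon
    obtain ⟨y, hy, hy0⟩ := hcon
    obtain ⟨x, hx, hx0⟩ : ∃ x ∈ Z, 0 < c x := by
      by_contra! h
      have := Finset.sum_nonpos h
      linarith
    have hWx : 0 < W.eval x := by
      rw [hcW x hx] at hx0
      exact (div_pos_iff_of_pos_right (by have := hd0 x hx; positivity)).1 hx0
    have hWy : W.eval y < 0 := by
      rw [hcW y hy] at hy0
      by_contra! h
      exact absurd (div_nonneg h (sq_nonneg _)) (not_le.2 hy0)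
    obtain ⟨t, ht⟩ := mem_range_of_exists_le_of_exists_ge W.continuous
      ⟨y, hWy.le⟩ ⟨x, hWx.le⟩
    exact hW t ht
  rw [hcoeff]
  calc |∑ z ∈ Z, c z * z| ≤ ∑ z ∈ Z, |c z * z| := Finset.abs_sum_le_sum_abs _ _
    _ ≤ ∑ z ∈ Z, c z * M := Finset.sum_le_sum fun z hz => by
        rw [abs_mul, abs_of_nonneg (hnn z hz)]
        exact mul_le_mul_of_nonneg_left (hM z hz) (hnn z hz)
    _ = M := by rw [← Finset.sum_mul, hsum, one_mul]

/-! ### Products over interlacing sets -/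

/-- Each non-maximal point of `Z` is dominated by a point of `W` in the gap to its right; `V`
collects these points. -/
theorem exists_subset_prod_erase_max_le (Z W : Finset ℝ) (hpos : ∀ z ∈ Z, 0 < z)
    (hint : ∀ z ∈ Z, ∀ z' ∈ Z, z < z' → ∃ w ∈ W, z < w ∧ w < z') (hne : Z.Nonempty) :
    ∃ m ∈ Z, (∀ z ∈ Z, z ≤ m) ∧ ∃ V ⊆ W, (∀ w ∈ V, w < m) ∧ V.card + 1 = Z.card ∧
      ∏ z ∈ Z.erase m, z ≤ ∏ w ∈ V, w := by
  induction Z using Finset.induction_on_max with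
  | empty => simp at hne
  | insert a Z ha ih =>
    have haZ : a ∉ Z := fun h => (ha a h).false
    refine ⟨a, Finset.mem_insert_self a Z, ?_, ?_⟩
    · intro z hz
      rcases Finset.mem_insert.1 hz with rfl | hz
      exacts [le_rfl, (ha z hz).le]
    rw [Finset.erase_insert haZ, Finset.card_insert_of_notMem haZ]
    rcases Z.eq_empty_or_nonempty with rfl | hZ
    · exact ⟨∅, by simp⟩
    obtain ⟨m, hm, hmax, V, hVW, hVm, hVc, hVp⟩ := ih
      (fun z hz => hpos z (Finset.mem_insert_of_mem hz))
      (fun z hz z' hz' => hint z (Finset.mem_insert_of_mem hz) z' (Finset.mem_insert_of_mem hz'))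
      hZ
    obtain ⟨w, hwW, hmw, hwa⟩ := hint m (Finset.mem_insert_of_mem hm) a
      (Finset.mem_insert_self a Z) (ha m hm)
    have hwV : w ∉ V := fun h => (hVm w h).not_gt hmw
    refine ⟨insert w V, Finset.insert_subset hwW hVW, ?_, ?_, ?_⟩
    · intro v hv
      rcases Finset.mem_insert.1 hv with rfl | hv
      exacts [hwa, (hVm v hv).trans (ha m hm)]
    · rw [Finset.card_insert_of_notMem hwV, hVc]
    · rw [Finset.prod_insert hwV, ← Finset.mul_prod_erase Z _ hm]
      have hm0 := hpos m (Finset.mem_insert_of_mem hm)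
      refine mul_le_mul hmw.le hVp (Finset.prod_nonneg fun z hz => ?_) (hm0.trans hmw).le
      exact (hpos z (Finset.mem_insert_of_mem (Finset.mem_of_mem_erase hz))).le

/-- After the pairing, only the largest `z ≤ l` and a single spare `w ≥ g` remain, which costs the
ratio `l / g` once, whatever the number of points. -/
theorem mul_prod_le_mul_prod_of_interlace {Z W : Finset ℝ} {g l : ℝ} (hg : 0 < g) (hgl : g ≤ l)
    (hZ : ∀ z ∈ Z, 0 < z ∧ z ≤ l) (hW : ∀ w ∈ W, g ≤ w) (hcard : Z.card = W.card)
    (hint : ∀ z ∈ Z, ∀ z' ∈ Z, z < z' → ∃ w ∈ W, z < w ∧ w < z') :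
    g * ∏ z ∈ Z, z ≤ l * ∏ w ∈ W, w := by
  rcases Z.eq_empty_or_nonempty with rfl | hne
  · obtain rfl : W = ∅ := by simpa using hcard.symm
    simpa using hgl
  obtain ⟨m, hm, -, V, hVW, -, hVc, hVp⟩ :=
    exists_subset_prod_erase_max_le Z W (fun z hz => (hZ z hz).1) hint hne
  obtain ⟨w, hw⟩ : ∃ w, W \ V = {w} := by
    rw [← Finset.card_eq_one, Finset.card_sdiff_of_subset hVW]; omega
  have hwW : w ∈ W := (Finset.mem_sdiff.1 (hw ▸ Finset.mem_singleton_self w)).1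
  rw [← Finset.mul_prod_erase Z _ hm, ← Finset.prod_sdiff hVW, hw, Finset.prod_singleton]
  have h0 : 0 ≤ ∏ z ∈ Z.erase m, z :=
    Finset.prod_nonneg fun z hz => (hZ z (Finset.mem_of_mem_erase hz)).1.le
  have h1 := (hZ m hm).2
  have h2 := hW w hwW
  calc g * (m * ∏ z ∈ Z.erase m, z) = m * (g * ∏ z ∈ Z.erase m, z) := by ring
    _ ≤ l * (w * ∏ v ∈ V, v) := mul_le_mul h1
        (mul_le_mul h2 hVp h0 (hg.le.trans h2)) (mul_nonneg hg.le h0) (hg.le.trans hgl)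

/-- The functional `P ↦ ∫ P(x) x^l dμ(x)` on polynomials. -/
noncomputable def momentFunctional (μ : Measure ℝ) [IsFiniteMeasure μ]
    (hK : IsCompact (convexHull ℝ μ.support)) (l : ℕ) : ℝ[X] →ₗ[ℝ] ℝ where
  toFun P := ∫ x, P.eval x * x ^ l ∂μ
  map_add' P Q := by
    have hi : ∀ P : ℝ[X], Integrable (fun x => P.eval x * x ^ l) μ := fun P =>
      (integrable_eval_of_isCompact_hull μ hK (P * X ^ l)).congr (ae_of_all _ fun x => by simp)
    rw [← integral_add (hi P) (hi Q)]
    simp only [eval_add, add_mul]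
  map_smul' c P := by
    simp only [eval_smul, smul_eq_mul, mul_assoc, integral_const_mul, RingHom.id_apply]

theorem momentFunctional_X_mul (μ : Measure ℝ) [IsFiniteMeasure μ]
    (hK : IsCompact (convexHull ℝ μ.support)) (l : ℕ) (P : ℝ[X]) :
    momentFunctional μ hK l (X * P) = momentFunctional μ hK (l + 1) P := by
  refine integral_congr_ae (ae_of_all _ fun x => ?_)
  simp only [eval_mul, eval_X]
  ring

theorem momentFunctional_C_mul (μ : Measure ℝ) [IsFiniteMeasure μ]
    (hK : IsCompact (convexHull ℝ μ.support)) (l : ℕ) (c : ℝ) (P : ℝ[X]) :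
    momentFunctional μ hK l (C c * P) = c * momentFunctional μ hK l P := by
  rw [C_mul', map_smul, smul_eq_mul]

/-! ### Normality of all indices and the Wronskian of neighbours -/

section MultipleOrthogonality

variable {d : ℕ} {μ : Fin d → Measure ℝ}

theorem IsAngelesco.isCompact_convexHull (hμ : IsAngelesco μ) (j : Fin d) :
    IsCompact (convexHull ℝ (μ j).support) := hμ.isCompact_hull j

theorem indexLength_add_unitIndex (n : Fin d → ℕ) (j : Fin d) :
    indexLength (n + unitIndex j) = indexLength n + 1 := by
  simp [indexLength, unitIndex, Finset.sum_add_distrib]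

theorem sub_unitIndex_add_unitIndex {n : Fin d → ℕ} {j : Fin d} (hj : 0 < n j) :
    n - unitIndex j + unitIndex j = n := by
  ext i
  by_cases h : i = j
  · subst h; simp [unitIndex]; omega
  · simp [unitIndex, h]

theorem le_add_unitIndex (n : Fin d → ℕ) (i j : Fin d) : n i ≤ (n + unitIndex j) i := by simp

theorem isCoprime_prod_X_sub_C {Z W : Finset ℝ} (h : Disjoint Z W) :
    IsCoprime (∏ z ∈ Z, (X - C z) : ℝ[X]) (∏ w ∈ W, (X - C w)) :=
  IsCoprime.prod_left fun z hz => IsCoprime.prod_right fun w hw =>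
    isCoprime_X_sub_C_of_isUnit_sub
      (sub_ne_zero.2 fun (h' : z = w) => Finset.disjoint_left.1 h hz (h'.symm ▸ hw)).isUnit

theorem natDegree_prod_prod_X_sub_C (Z : Fin d → Finset ℝ) :
    (∏ j, ∏ z ∈ Z j, (X - C z) : ℝ[X]).natDegree = ∑ j, (Z j).card := by
  rw [natDegree_prod_of_monic _ _ fun j _ => monic_prod_X_sub_C_finset (Z j)]
  simp_rw [natDegree_prod_X_sub_C]

theorem monic_prod_prod_X_sub_C (Z : Fin d → Finset ℝ) :
    (∏ j, ∏ z ∈ Z j, (X - C z) : ℝ[X]).Monic :=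
  monic_prod_of_monic _ _ fun j _ => monic_prod_X_sub_C_finset (Z j)

theorem IsMonicTypeII.orthogonal_of_le {n m : Fin d → ℕ} {P : ℝ[X]} (hP : IsMonicTypeII μ m P)
    (hnm : ∀ i, n i ≤ m i) (i : Fin d) (l : ℕ) (hl : l < n i) :
    ∫ x, P.eval x * x ^ l ∂(μ i) = 0 := hP.1.2 i l (hl.trans_le (hnm i))

variable [∀ j, IsFiniteMeasure (μ j)]

theorem exists_zeros_of_orthogonal (hsupp : ∀ j, (μ j).support.Infinite) (hμ : IsAngelesco μ)
    {T S : ℝ[X]} (hT : ∀ x, 0 ≤ T.eval x) (hTS : T * S ≠ 0) {n : Fin d → ℕ}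
    (h : ∀ j, ∀ l < n j, ∫ x, (T * S).eval x * x ^ l ∂(μ j) = 0) :
    ∃ Z : Fin d → Finset ℝ, (∀ j, (Z j : Set ℝ) ⊆ hullSupp μ j) ∧ (∀ j, n j ≤ (Z j).card) ∧
      (∏ j, ∏ z ∈ Z j, (X - C z)) ∣ S := by
  choose Z hZ hc hd using fun j =>
    exists_zeros_in_hull (μ j) (hμ.isCompact_convexHull j) (hsupp j) hT hTS (h j)
  refine ⟨Z, hZ, hc, Fintype.prod_dvd_of_coprime (fun i j hij => ?_) hd⟩
  refine isCoprime_prod_X_sub_C (Finset.disjoint_left.2 fun z hzi hzj => ?_)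
  exact Set.disjoint_left.1 (hμ.disjoint_hull i j hij) (hZ i hzi) (hZ j hzj)

theorem indexLength_le_natDegree_of_orthogonal (hsupp : ∀ j, (μ j).support.Infinite)
    (hμ : IsAngelesco μ) {T S : ℝ[X]} (hT : ∀ x, 0 ≤ T.eval x) (hTS : T * S ≠ 0) {n : Fin d → ℕ}
    (h : ∀ j, ∀ l < n j, ∫ x, (T * S).eval x * x ^ l ∂(μ j) = 0) :
    indexLength n ≤ S.natDegree := by
  obtain ⟨Z, -, hc, hd⟩ := exists_zeros_of_orthogonal hsupp hμ hT hTS h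
  have := natDegree_le_of_dvd hd (right_ne_zero_of_mul hTS)
  rw [natDegree_prod_prod_X_sub_C] at this
  exact (Finset.sum_le_sum fun j _ => hc j).trans this

theorem eq_zero_of_orthogonal_of_degree_lt (hsupp : ∀ j, (μ j).support.Infinite)
    (hμ : IsAngelesco μ) {R : ℝ[X]} {n : Fin d → ℕ}
    (h : ∀ j, ∀ l < n j, ∫ x, R.eval x * x ^ l ∂(μ j) = 0) (hR : R.degree < indexLength n) :
    R = 0 := by
  by_contra h0
  have := indexLength_le_natDegree_of_orthogonal hsupp hμ (T := 1) (S := R) (by simp)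
    (by simpa using h0) (by simpa using h)
  exact absurd ((natDegree_lt_iff_degree_lt h0).2 hR) (not_lt.2 this)

theorem IsMonicTypeII.exists_zeros (hsupp : ∀ j, (μ j).support.Infinite) (hμ : IsAngelesco μ)
    {n : Fin d → ℕ} {P : ℝ[X]} (hP : IsMonicTypeII μ n P) :
    ∃ Z : Fin d → Finset ℝ, (∀ j, (Z j : Set ℝ) ⊆ hullSupp μ j) ∧ (∀ j, (Z j).card = n j) ∧
      P = ∏ j, ∏ z ∈ Z j, (X - C z) := by
  obtain ⟨Z, hZ, hc, hd⟩ := exists_zeros_of_orthogonal hsupp hμ (T := 1) (S := P) (by simp)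
    (by simpa using hP.2.1.ne_zero) (by simpa using hP.1.2)
  have hle := natDegree_le_of_dvd hd hP.2.1.ne_zero
  rw [natDegree_prod_prod_X_sub_C, hP.2.2] at hle
  have heq := le_antisymm (Finset.sum_le_sum fun j _ => hc j) hle
  refine ⟨Z, hZ, fun j => ?_, ?_⟩
  · exact ((Finset.sum_eq_sum_iff_of_le fun j _ => hc j).1 heq j (Finset.mem_univ j)).symm
  · refine (eq_of_monic_of_dvd_of_natDegree_le (monic_prod_prod_X_sub_C Z) hP.2.1 hd ?_)
    rw [natDegree_prod_prod_X_sub_C, hP.2.2, indexLength, heq]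

theorem orthogonal_sub (hμ : IsAngelesco μ) {n : Fin d → ℕ} {P Q : ℝ[X]}
    (hP : ∀ j, ∀ l < n j, ∫ x, P.eval x * x ^ l ∂(μ j) = 0)
    (hQ : ∀ j, ∀ l < n j, ∫ x, Q.eval x * x ^ l ∂(μ j) = 0) (A B : ℝ) (j : Fin d) (l : ℕ)
    (hl : l < n j) : ∫ x, (C A * P - C B * Q).eval x * x ^ l ∂(μ j) = 0 := by
  have hP' : momentFunctional (μ j) (hμ.isCompact_convexHull j) l P = 0 := hP j l hl
  have hQ' : momentFunctional (μ j) (hμ.isCompact_convexHull j) l Q = 0 := hQ j l hl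
  change momentFunctional (μ j) (hμ.isCompact_convexHull j) l _ = 0
  rw [map_sub, momentFunctional_C_mul, momentFunctional_C_mul, hP', hQ', mul_zero, mul_zero,
    sub_zero]

theorem IsTypeII.eq_C_mul_of_isMonicTypeII (hsupp : ∀ j, (μ j).support.Infinite)
    (hμ : IsAngelesco μ) {n : Fin d → ℕ} {P R : ℝ[X]} (hR : IsTypeII μ n R)
    (hP : IsMonicTypeII μ n P) : R = C (R.coeff (indexLength n)) * P := by
  have := eq_zero_of_orthogonal_of_degree_lt hsupp hμ
    (orthogonal_sub hμ hR.2 hP.1.2 1 (R.coeff (indexLength n))) (by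
      rw [degree_lt_iff_coeff_zero]
      intro m hm
      rcases hm.eq_or_lt with rfl | hm
      · have : P.coeff (indexLength n) = 1 := by rw [← hP.2.2]; exact hP.2.1
        simp [this]
      · simp [coeff_eq_zero_of_natDegree_lt (hR.1.trans_lt hm),
          coeff_eq_zero_of_natDegree_lt (hP.2.2.trans_lt hm)])
  rw [C_1, one_mul] at this
  exact sub_eq_zero.1 this

theorem IsMonicTypeII.unique (hsupp : ∀ j, (μ j).support.Infinite)
    (hμ : IsAngelesco μ) {n : Fin d → ℕ} {P R : ℝ[X]} (hR : IsMonicTypeII μ n R)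
    (hP : IsMonicTypeII μ n P) : R = P := by
  have h := hR.1.eq_C_mul_of_isMonicTypeII hsupp hμ hP
  have h1 : R.coeff (indexLength n) = 1 := by rw [← hR.2.2]; exact hR.2.1
  rwa [h1, C_1, one_mul] at h

/-- There are `|n|` linear conditions on a space of dimension `|n| + 1`. The zero count then forces
the degree of a nonzero solution to be exactly `|n|`, so it can be made monic. -/
theorem exists_isMonicTypeII (hsupp : ∀ j, (μ j).support.Infinite) (hμ : IsAngelesco μ)
    (n : Fin d → ℕ) : ∃ P, IsMonicTypeII μ n P := by
  let L : degreeLT ℝ (indexLength n + 1) →ₗ[ℝ] ((Σ j, Fin (n j)) → ℝ) :=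
    (LinearMap.pi fun p : Σ j, Fin (n j) =>
      momentFunctional (μ p.1) (hμ.isCompact_convexHull p.1) p.2).comp (Submodule.subtype _)
  have : FiniteDimensional ℝ (degreeLT ℝ (indexLength n + 1)) :=
    (degreeLTEquiv ℝ (indexLength n + 1)).symm.finiteDimensional
  obtain ⟨⟨P, hPd⟩, hPker, hP0⟩ := (Submodule.ne_bot_iff _).1
    (LinearMap.ker_ne_bot_of_finrank_lt (f := L) (by
      rw [(degreeLTEquiv ℝ (indexLength n + 1)).finrank_eq, Module.finrank_fin_fun]
      simp [indexLength]))
  have hP0' : P ≠ 0 := fun h => hP0 (Subtype.ext h)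
  have horth : ∀ j, ∀ l < n j, ∫ x, P.eval x * x ^ l ∂(μ j) = 0 := fun j l hl =>
    congrFun (LinearMap.mem_ker.1 hPker) ⟨j, ⟨l, hl⟩⟩
  have hle : P.natDegree ≤ indexLength n :=
    Nat.lt_succ_iff.1 ((natDegree_lt_iff_degree_lt hP0').2 (mem_degreeLT.1 hPd))
  have hge := indexLength_le_natDegree_of_orthogonal hsupp hμ (T := 1) (S := P) (by simp)
    (by simpa using hP0') (by simpa using horth)
  have hlc : P.leadingCoeff⁻¹ ≠ 0 := inv_ne_zero (leadingCoeff_ne_zero.2 hP0')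
  have hdeg : (C P.leadingCoeff⁻¹ * P).natDegree = indexLength n := by
    rw [natDegree_C_mul hlc]; exact le_antisymm hle hge
  refine ⟨C P.leadingCoeff⁻¹ * P, ⟨hdeg.le, fun j l hl => ?_⟩, ?_, hdeg⟩
  · simpa using orthogonal_sub hμ horth horth P.leadingCoeff⁻¹ 0 j l hl
  · rw [mul_comm]; exact monic_mul_leadingCoeff_inv hP0'

theorem isPerfect_of_isAngelesco (hsupp : ∀ j, (μ j).support.Infinite) (hμ : IsAngelesco μ) :
    IsPerfect μ := fun n => by
  obtain ⟨P, hP⟩ := exists_isMonicTypeII hsupp hμ n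
  exact ⟨P, hP, fun R hR => ⟨_, hR.eq_C_mul_of_isMonicTypeII hsupp hμ hP⟩⟩

/-- If it vanished at `x`, some nonzero `A P - B Q` would equal `(X - x) ^ 2 * S` with `deg S <
|n|`. This combination keeps the orthogonality of index `n`, which forces `S` to have at least `|n|`
zeros. -/
theorem wronskian_eval_ne_zero (hsupp : ∀ j, (μ j).support.Infinite) (hμ : IsAngelesco μ)
    {n : Fin d → ℕ} {j : Fin d} {P Q : ℝ[X]} (hP : IsMonicTypeII μ (n + unitIndex j) P)
    (hQ : IsMonicTypeII μ n Q) (x : ℝ) :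
    (derivative P * Q - P * derivative Q).eval x ≠ 0 := by
  have hPd : P.natDegree = indexLength n + 1 := hP.2.2.trans (indexLength_add_unitIndex n j)
  have hPc : P.coeff (indexLength n + 1) = 1 := by rw [← hPd]; exact hP.2.1
  have hQc : Q.coeff (indexLength n) = 1 := by rw [← hQ.2.2]; exact hQ.2.1
  have hQc' : Q.coeff (indexLength n + 1) = 0 := coeff_eq_zero_of_natDegree_lt (by rw [hQ.2.2]; simp)
  have key : ∀ A B : ℝ, (C A * P - C B * Q).eval x = 0 →
      (derivative (C A * P - C B * Q)).eval x = 0 → A = 0 ∧ B = 0 := by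
    intro A B h0 h1
    suffices hR : C A * P - C B * Q = 0 by
      have hA : A = 0 := by
        have := congrArg (coeff · (indexLength n + 1)) hR
        simpa [hPc, hQc'] using this
      subst hA
      have := congrArg (coeff · (indexLength n)) hR
      exact ⟨rfl, by simpa [hQc] using this⟩
    by_contra hR
    have hroot := (one_lt_rootMultiplicity_iff_isRoot hR).2 ⟨h0, h1⟩
    obtain ⟨S, hS⟩ := (le_rootMultiplicity_iff hR).1 hroot
    have horth := orthogonal_sub hμ (n := n) (hP.orthogonal_of_le fun i => le_add_unitIndex n i j)
      (hQ.orthogonal_of_le fun i => le_rfl) A B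
    have hdR : (C A * P - C B * Q).natDegree ≤ indexLength n + 1 :=
      (natDegree_sub_le _ _).trans (max_le ((natDegree_C_mul_le _ _).trans hPd.le)
        ((natDegree_C_mul_le _ _).trans (by rw [hQ.2.2]; simp)))
    rw [hS] at horth hR hdR
    have := indexLength_le_natDegree_of_orthogonal hsupp hμ
      (fun y => by simpa using sq_nonneg (y - x)) hR horth
    rw [natDegree_mul (left_ne_zero_of_mul hR) (right_ne_zero_of_mul hR), natDegree_pow,
      natDegree_X_sub_C] at hdR
    omega
  intro hW
  simp only [eval_sub, eval_mul] at hW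
  -- Both natural kernel vectors of the singular matrix of values and derivatives must be trivial.
  -- Hence all its entries vanish, and `P` itself has a double zero.
  have h1 := key (Q.eval x) (P.eval x) (by simp; ring) (by simp; linarith)
  have h2 := key ((derivative Q).eval x) ((derivative P).eval x) (by simp; linarith)
    (by simp; ring)
  have h3 := key 1 0 (by simp [h1.2]) (by simp [h2.2])
  exact one_ne_zero h3.1

end MultipleOrthogonality

/-! ### The nearest-neighbour recurrence -/

section Recurrence

variable {d : ℕ} {μ : Fin d → Measure ℝ}

theorem IsMonicTypeII.coeff_indexLength {n : Fin d → ℕ} {P : ℝ[X]} (hP : IsMonicTypeII μ n P) :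
    P.coeff (indexLength n) = 1 := by
  rw [← hP.2.2]; exact hP.2.1

theorem coeff_sum_neighbours {P : (Fin d → ℕ) → ℝ[X]}
    (hP : ∀ n, IsMonicTypeII μ n (P n)) {n : Fin d → ℕ} {c : Fin d → ℝ}
    (hc : ∀ k, n k = 0 → c k = 0) {m : ℕ} (hm : indexLength n ≤ m) :
    (∑ k, C (c k) * P (n - unitIndex k)).coeff m = 0 := by
  rw [finsetSum_coeff]
  refine Finset.sum_eq_zero fun k _ => ?_
  rw [coeff_C_mul]
  rcases (n k).eq_zero_or_pos with h | h
  -- Here `n - unitIndex k` truncates to `n`, of full degree `|n|`; only `c k = 0` removes the term.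
  · rw [hc k h, zero_mul]
  · have := indexLength_add_unitIndex (n - unitIndex k) k
    rw [sub_unitIndex_add_unitIndex h] at this
    rw [coeff_eq_zero_of_natDegree_lt (by rw [(hP _).2.2]; omega), mul_zero]

variable [∀ j, IsFiniteMeasure (μ j)]

theorem IsMonicTypeII.momentFunctional_eq_zero (hμ : IsAngelesco μ) {n : Fin d → ℕ} {P : ℝ[X]}
    (hP : IsMonicTypeII μ n P) {i : Fin d} {l : ℕ} (hl : l < n i) :
    momentFunctional (μ i) (hμ.isCompact_convexHull i) l P = 0 := hP.1.2 i l hl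

theorem momentFunctional_sum_neighbours (hμ : IsAngelesco μ) {P : (Fin d → ℕ) → ℝ[X]}
    (hP : ∀ n, IsMonicTypeII μ n (P n)) {n : Fin d → ℕ} (c : Fin d → ℝ) {i : Fin d} {l : ℕ}
    (hl : l < n i) :
    momentFunctional (μ i) (hμ.isCompact_convexHull i) l (∑ k, C (c k) * P (n - unitIndex k)) =
      c i * momentFunctional (μ i) (hμ.isCompact_convexHull i) l (P (n - unitIndex i)) := by
  rw [map_sum, Finset.sum_eq_single i]
  · rw [momentFunctional_C_mul]
  · intro k _ hk
    rw [momentFunctional_C_mul, (hP _).momentFunctional_eq_zero hμ, mul_zero]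
    simpa [unitIndex, Pi.single_eq_of_ne hk.symm] using hl
  · simp

/-- This yields uniqueness: the coefficient of `x^|n|` isolates `b n j`, and the moment of order `n
j - 1` against `μ j` isolates `a n j`. -/
theorem recurrence_coeff_characterization (hμ : IsAngelesco μ) {P : (Fin d → ℕ) → ℝ[X]}
    (hP : ∀ n, IsMonicTypeII μ n (P n)) {a b : (Fin d → ℕ) → Fin d → ℝ}
    (ha : ∀ n l, n l = 0 → a n l = 0)
    (hrec : ∀ n j, X * P n =
      P (n + unitIndex j) + C (b n j) * P n + ∑ l, C (a n l) * P (n - unitIndex l))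
    (n : Fin d → ℕ) (j : Fin d) :
    b n j = (X * P n - P (n + unitIndex j)).coeff (indexLength n) ∧
    (0 < n j → momentFunctional (μ j) (hμ.isCompact_convexHull j) (n j) (P n) =
      a n j * momentFunctional (μ j) (hμ.isCompact_convexHull j) (n j - 1)
        (P (n - unitIndex j))) := by
  constructor
  · rw [hrec n j, add_assoc, add_sub_cancel_left, coeff_add, coeff_C_mul,
      (hP n).coeff_indexLength, coeff_sum_neighbours hP (ha n) le_rfl, mul_one, add_zero]
  · intro hj
    have hlt : n j - 1 < n j := by omega
    have h1 : n j = n j - 1 + 1 := by omega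
    have h := congrArg (momentFunctional (μ j) (hμ.isCompact_convexHull j) (n j - 1)) (hrec n j)
    rw [momentFunctional_X_mul, ← h1, map_add, map_add, momentFunctional_C_mul,
      (hP n).momentFunctional_eq_zero hμ hlt,
      (hP _).momentFunctional_eq_zero hμ (hlt.trans_le (le_add_unitIndex n j j)),
      momentFunctional_sum_neighbours hμ hP _ hlt] at h
    simpa using h

/-- The remainder has degree below `|n|` by the choice of `b`. Its moments of order `l < n i` vanish
automatically except for `l = n i - 1`, where `a n i` is chosen to cancel; `P (n + unitIndex j)`
does not contribute, so `a` is independent of `j`. The zero count then kills the remainder. -/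
theorem exists_recurrence_coeff (hsupp : ∀ j, (μ j).support.Infinite) (hμ : IsAngelesco μ)
    {P : (Fin d → ℕ) → ℝ[X]} (hP : ∀ n, IsMonicTypeII μ n (P n))
    (hne : ∀ n j, momentFunctional (μ j) (hμ.isCompact_convexHull j) (n j) (P n) ≠ 0) :
    ∃ a b : (Fin d → ℕ) → Fin d → ℝ, (∀ n l, n l = 0 → a n l = 0) ∧
      ∀ n j, X * P n =
        P (n + unitIndex j) + C (b n j) * P n + ∑ l, C (a n l) * P (n - unitIndex l) := by
  let h : (Fin d → ℕ) → Fin d → ℝ := fun n j =>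
    momentFunctional (μ j) (hμ.isCompact_convexHull j) (n j) (P n)
  let a : (Fin d → ℕ) → Fin d → ℝ := fun n j =>
    if n j = 0 then 0 else h n j / h (n - unitIndex j) j
  let b : (Fin d → ℕ) → Fin d → ℝ := fun n j =>
    (X * P n - P (n + unitIndex j)).coeff (indexLength n)
  have ha : ∀ n l, n l = 0 → a n l = 0 := fun n l hl => if_pos hl
  refine ⟨a, b, ha, fun n j => ?_⟩
  have hR : X * P n - P (n + unitIndex j) - C (b n j) * P n -
      ∑ l, C (a n l) * P (n - unitIndex l) = 0 := by
    refine eq_zero_of_orthogonal_of_degree_lt hsupp hμ (n := n) (fun i l hl => ?_) ?_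
    · change momentFunctional (μ i) (hμ.isCompact_convexHull i) l _ = 0
      rw [map_sub, map_sub, map_sub, momentFunctional_C_mul, momentFunctional_X_mul,
        (hP n).momentFunctional_eq_zero hμ hl,
        (hP _).momentFunctional_eq_zero hμ (hl.trans_le (le_add_unitIndex n i j)),
        momentFunctional_sum_neighbours hμ hP _ hl, mul_zero, sub_zero, sub_zero]
      have hi : (n - unitIndex i) i = n i - 1 := by simp [unitIndex]
      rcases Nat.lt_or_ge (l + 1) (n i) with hl' | hl'
      · rw [(hP n).momentFunctional_eq_zero hμ hl',
          (hP _).momentFunctional_eq_zero hμ (by rw [hi]; omega), mul_zero, sub_zero]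
      · have hl1 : l + 1 = n i := by omega
        have hl2 : l = (n - unitIndex i) i := by omega
        have hai : a n i = h n i / h (n - unitIndex i) i := if_neg (by omega)
        have h0 := hne (n - unitIndex i) i
        rw [hl1, hai, hl2]
        exact sub_eq_zero.2 (div_mul_cancel₀ _ h0).symm
    · rw [degree_lt_iff_coeff_zero]
      intro m hm
      rw [coeff_sub, coeff_sum_neighbours hP (ha n) hm, sub_zero, coeff_sub, coeff_C_mul]
      rcases hm.eq_or_lt with rfl | hm
      · rw [(hP n).coeff_indexLength, mul_one, sub_self]
      · obtain ⟨k, rfl⟩ : ∃ k, m = k + 1 := ⟨m - 1, by omega⟩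
        rw [coeff_eq_zero_of_natDegree_lt (p := P n) (by rw [(hP n).2.2]; exact hm), mul_zero,
          sub_zero, coeff_sub, coeff_X_mul]
        rcases (Nat.lt_succ_iff.1 hm).eq_or_lt with rfl | hk
        · rw [(hP n).coeff_indexLength, ← indexLength_add_unitIndex n j,
            (hP _).coeff_indexLength, sub_self]
        · rw [coeff_eq_zero_of_natDegree_lt (by rw [(hP n).2.2]; exact hk),
            coeff_eq_zero_of_natDegree_lt
              (by rw [(hP _).2.2, indexLength_add_unitIndex]; omega), sub_self]
  linear_combination hR

end Recurrence

/-! ### Geometry of the segments -/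

section Hulls

variable {d : ℕ} {μ : Fin d → Measure ℝ}

theorem hullSupp_nonempty (hsupp : ∀ j, (μ j).support.Infinite) (j : Fin d) :
    (hullSupp μ j).Nonempty := (hsupp j).nonempty.mono (subset_convexHull ℝ _)

theorem hullSupp_subset_hullMax (j : Fin d) : hullSupp μ j ⊆ hullMax μ :=
  (Set.subset_iUnion _ j).trans (subset_convexHull ℝ _)

theorem isBounded_hullMax (hμ : IsAngelesco μ) : Bornology.IsBounded (hullMax μ) :=
  isBounded_convexHull.2 (isCompact_iUnion hμ.isCompact_hull).isBounded

theorem abs_sub_le_diam_hullMax (hμ : IsAngelesco μ) {i j : Fin d} {x y : ℝ}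
    (hx : x ∈ hullSupp μ i) (hy : y ∈ hullSupp μ j) :
    |x - y| ≤ Metric.diam (hullMax μ) :=
  Metric.dist_le_diam_of_mem (isBounded_hullMax hμ) (hullSupp_subset_hullMax i hx)
    (hullSupp_subset_hullMax j hy)

theorem abs_le_sSup_abs_hullMax (hμ : IsAngelesco μ) {j : Fin d} {x : ℝ}
    (hx : x ∈ hullSupp μ j) : |x| ≤ sSup ((fun x : ℝ => |x|) '' hullMax μ) := by
  refine le_csSup ?_ (Set.mem_image_of_mem _ (hullSupp_subset_hullMax j hx))
  obtain ⟨r, hr⟩ := (isBounded_hullMax hμ).exists_norm_le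
  exact ⟨r, by rintro _ ⟨y, hy, rfl⟩; exact hr y hy⟩

theorem gapMin_nonneg : 0 ≤ gapMin μ :=
  Real.sInf_nonneg (by rintro _ ⟨i, j, -, x, -, y, -, rfl⟩; exact abs_nonneg _)

theorem gapMin_le {i j : Fin d} (hij : i ≠ j) {x y : ℝ} (hx : x ∈ hullSupp μ i)
    (hy : y ∈ hullSupp μ j) : gapMin μ ≤ |x - y| :=
  csInf_le ⟨0, by rintro _ ⟨i, j, -, x, -, y, -, rfl⟩; exact abs_nonneg _⟩
    ⟨i, j, hij, x, hx, y, hy, rfl⟩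

theorem gapMin_pos (hsupp : ∀ j, (μ j).support.Infinite) (hμ : IsAngelesco μ) {i j : Fin d}
    (hij : i ≠ j) : 0 < gapMin μ := by
  have hcomp : IsCompact {r : ℝ | ∃ i j, i ≠ j ∧ ∃ x ∈ hullSupp μ i, ∃ y ∈ hullSupp μ j,
      r = |x - y|} := by
    have : {r : ℝ | ∃ i j, i ≠ j ∧ ∃ x ∈ hullSupp μ i, ∃ y ∈ hullSupp μ j, r = |x - y|} =
        ⋃ p ∈ {p : Fin d × Fin d | p.1 ≠ p.2},
          (fun q : ℝ × ℝ => |q.1 - q.2|) '' (hullSupp μ p.1 ×ˢ hullSupp μ p.2) := by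
      ext r
      simp only [Set.mem_ofPred_eq, Set.mem_iUnion, Set.mem_image, Set.mem_prod, Prod.exists,
        exists_prop]
      constructor
      · rintro ⟨i, j, h, x, hx, y, hy, rfl⟩
        exact ⟨i, j, h, x, y, ⟨hx, hy⟩, rfl⟩
      · rintro ⟨i, j, h, x, y, ⟨hx, hy⟩, rfl⟩
        exact ⟨i, j, h, x, hx, y, hy, rfl⟩
    rw [this]
    exact (Set.toFinite _).isCompact_biUnion fun p _ =>
      ((hμ.isCompact_hull p.1).prod (hμ.isCompact_hull p.2)).image (by fun_prop)
  obtain ⟨x, hx⟩ := hullSupp_nonempty hsupp i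
  obtain ⟨y, hy⟩ := hullSupp_nonempty hsupp j
  obtain ⟨i', j', h, x', hx', y', hy', he⟩ := hcomp.sInf_mem ⟨_, i, j, hij, x, hx, y, hy, rfl⟩
  change gapMin μ = _ at he
  rw [he, abs_pos, sub_ne_zero]
  rintro rfl
  exact Set.disjoint_left.1 (hμ.disjoint_hull i' j' h) hx' hy'

theorem exists_center_hullSupp (hμ : IsAngelesco μ) (j : Fin d) : ∃ c : ℝ, ∀ x ∈ hullSupp μ j, |x - c| ≤ Metric.diam (hullSupp μ j) / 2 := by
  have hb := (hμ.isCompact_hull j).isBounded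
  refine ⟨(sInf (hullSupp μ j) + sSup (hullSupp μ j)) / 2, fun x hx => ?_⟩
  rw [Real.diam_eq hb, abs_le]
  have h1 := csInf_le hb.bddBelow hx
  have h2 := le_csSup hb.bddAbove hx
  constructor <;> linarith

/-- On the connected product of the two segments `x - z` has no zero, hence constant sign. -/
theorem exists_sign_sub_hullSupp (hμ : IsAngelesco μ) {i j : Fin d} (hij : i ≠ j) :
    ∃ s : ℝ, (s = 1 ∨ s = -1) ∧ ∀ x ∈ hullSupp μ j, ∀ z ∈ hullSupp μ i, 0 < s * (x - z) := by
  by_contra! hcon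
  obtain ⟨x, hx, z, hz, h1⟩ := hcon 1 (Or.inl rfl)
  obtain ⟨x', hx', z', hz', h2⟩ := hcon (-1) (Or.inr rfl)
  have hpre : IsPreconnected (hullSupp μ j ×ˢ hullSupp μ i) :=
    (convex_convexHull ℝ (μ j).support).isPreconnected.prod
      (convex_convexHull ℝ (μ i).support).isPreconnected
  obtain ⟨⟨y, w⟩, ⟨hy, hw⟩, h0⟩ := hpre.intermediate_value (f := fun q : ℝ × ℝ => q.1 - q.2)
    (Set.mk_mem_prod hx hz) (Set.mk_mem_prod hx' hz') (by fun_prop)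
    (show (0 : ℝ) ∈ Set.Icc (x - z) (x' - z') from ⟨by linarith, by linarith⟩)
  have : y = w := sub_eq_zero.1 h0
  subst this
  exact Set.disjoint_left.1 (hμ.disjoint_hull i j hij) hw hy

/-- The interlacing inequality is applied to the distances from `x`, which lie between `gapMin μ`
and the diameter of `hullMax μ`. -/
theorem gapMin_mul_prod_abs_le (hsupp : ∀ j, (μ j).support.Infinite) (hμ : IsAngelesco μ)
    {i j : Fin d} (hij : i ≠ j) {Z W : Finset ℝ} (hZ : (Z : Set ℝ) ⊆ hullSupp μ i)
    (hW : (W : Set ℝ) ⊆ hullSupp μ i) (hcard : Z.card = W.card)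
    (hint : ∀ z ∈ Z, ∀ z' ∈ Z, z < z' → ∃ w ∈ W, z < w ∧ w < z') {x : ℝ}
    (hx : x ∈ hullSupp μ j) :
    gapMin μ * ∏ z ∈ Z, |x - z| ≤ Metric.diam (hullMax μ) * ∏ w ∈ W, |x - w| := by
  classical
  obtain ⟨s, hs, hpos⟩ := exists_sign_sub_hullSupp hμ hij
  have habs : ∀ z ∈ hullSupp μ i, |x - z| = s * (x - z) := fun z hz => by
    have h1 := hpos x hx z hz
    have h2 : |s| = 1 := by rcases hs with rfl | rfl <;> simp
    rw [← abs_of_pos h1, abs_mul, h2, one_mul]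
  have hinj : Function.Injective fun z : ℝ => s * (x - z) := by
    intro z w h
    rcases hs with rfl | rfl <;> simp only at h <;> linarith
  rw [Finset.prod_congr rfl fun z hz => habs z (hZ hz),
    Finset.prod_congr rfl fun w hw => habs w (hW hw)]
  have := mul_prod_le_mul_prod_of_interlace (Z := Z.image fun z => s * (x - z))
    (W := W.image fun w => s * (x - w)) (gapMin_pos hsupp hμ hij)
    (l := Metric.diam (hullMax μ)) ?_ ?_ ?_ ?_ ?_
  · rwa [Finset.prod_image hinj.injOn, Finset.prod_image hinj.injOn] at this
  · obtain ⟨z, hz⟩ := hullSupp_nonempty hsupp i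
    exact (gapMin_le hij hz hx).trans (abs_sub_le_diam_hullMax hμ hz hx)
  · simp only [Finset.forall_mem_image]
    intro z hz
    exact ⟨hpos x hx z (hZ hz), habs z (hZ hz) ▸ abs_sub_le_diam_hullMax hμ hx (hZ hz)⟩
  · simp only [Finset.forall_mem_image]
    intro w hw
    exact habs w (hW hw) ▸ gapMin_le hij.symm hx (hW hw)
  · rw [Finset.card_image_of_injective _ hinj, Finset.card_image_of_injective _ hinj, hcard]
  · simp only [Finset.forall_mem_image, Finset.exists_mem_image]
    intro z hz z' hz' h
    -- For `s = 1` passing to distances reverses the order of the points; for `s = -1` it preserves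
    -- it.
    rcases hs with rfl | rfl
    · obtain ⟨w, hw, h1, h2⟩ := hint z' hz' z hz (by linarith)
      exact ⟨w, hw, by linarith, by linarith⟩
    · obtain ⟨w, hw, h1, h2⟩ := hint z hz z' hz' (by linarith)
      exact ⟨w, hw, by linarith, by linarith⟩

/-! ### Interlacing of zeros and the bounds it gives -/

variable [∀ j, IsFiniteMeasure (μ j)]

/-- The intermediate zero lies in the `i`-th segment by convexity, so disjointness puts it in `W i`.
-/
theorem exists_zero_between (hsupp : ∀ j, (μ j).support.Infinite) (hμ : IsAngelesco μ)
    {n : Fin d → ℕ} {j : Fin d} {Z W : Fin d → Finset ℝ}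
    (hZ : ∀ i, (Z i : Set ℝ) ⊆ hullSupp μ i) (hW : ∀ i, (W i : Set ℝ) ⊆ hullSupp μ i)
    (hP : IsMonicTypeII μ (n + unitIndex j) (∏ i, ∏ z ∈ Z i, (X - C z)))
    (hQ : IsMonicTypeII μ n (∏ i, ∏ w ∈ W i, (X - C w))) {i : Fin d} {z z' : ℝ}
    (hz : z ∈ Z i) (hz' : z' ∈ Z i) (hzz : z < z') : ∃ w ∈ W i, z < w ∧ w < z' := by
  have hroot : ∀ y ∈ Z i, (∏ i, ∏ z ∈ Z i, (X - C z) : ℝ[X]).eval y = 0 := fun y hy => by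
    rw [eval_prod]
    refine Finset.prod_eq_zero (Finset.mem_univ i) ?_
    rw [eval_prod]
    exact Finset.prod_eq_zero hy (by simp)
  obtain ⟨w, hzw, hwz, hw⟩ := exists_eval_eq_zero_between_of_wronskian_ne_zero
    (wronskian_eval_ne_zero hsupp hμ hP hQ) hzz (hroot z hz) (hroot z' hz')
  simp only [eval_prod, Finset.prod_eq_zero_iff, Finset.mem_univ, true_and, eval_sub, eval_X,
    eval_C, sub_eq_zero] at hw
  obtain ⟨k, y, hy, rfl⟩ := hw
  have hwi : w ∈ hullSupp μ i := (convex_convexHull ℝ (μ i).support).ordConnected.out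
    (hZ i hz) (hZ i hz') ⟨hzw.le, hwz.le⟩
  obtain rfl : k = i := by
    by_contra hk
    exact Set.disjoint_left.1 (hμ.disjoint_hull k i hk) (hW k hy) hwi
  exact ⟨w, hy, hzw, hwz⟩

theorem prod_prod_abs_le (hsupp : ∀ j, (μ j).support.Infinite) (hμ : IsAngelesco μ)
    {n : Fin d → ℕ} {j : Fin d} {Z W : Fin d → Finset ℝ}
    (hZ : ∀ i, (Z i : Set ℝ) ⊆ hullSupp μ i) (hW : ∀ i, (W i : Set ℝ) ⊆ hullSupp μ i)
    (hcard : ∀ i, i ≠ j → (Z i).card = (W i).card)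
    (hP : IsMonicTypeII μ (n + unitIndex j) (∏ i, ∏ z ∈ Z i, (X - C z)))
    (hQ : IsMonicTypeII μ n (∏ i, ∏ w ∈ W i, (X - C w))) {x : ℝ} (hx : x ∈ hullSupp μ j) :
    ∏ i ∈ Finset.univ.erase j, ∏ z ∈ Z i, |x - z| ≤
      (Metric.diam (hullMax μ) / gapMin μ) ^ (d - 1) *
        ∏ i ∈ Finset.univ.erase j, ∏ w ∈ W i, |x - w| := by
  have hc : (Finset.univ.erase j).card = d - 1 := by
    rw [Finset.card_erase_of_mem (Finset.mem_univ j), Finset.card_univ, Fintype.card_fin]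
  rw [← hc, ← Finset.prod_const, ← Finset.prod_mul_distrib]
  refine Finset.prod_le_prod (fun i _ => Finset.prod_nonneg fun z _ => abs_nonneg _)
    fun i hi => ?_
  have hij := Finset.ne_of_mem_erase hi
  have h := gapMin_mul_prod_abs_le hsupp hμ hij (hZ i) (hW i) (hcard i hij)
    (fun z hz z' hz' => exists_zero_between hsupp hμ hZ hW hP hQ hz hz') hx
  -- Positivity of the gap comes from `i ≠ j`; for `d = 1` the product is empty and no division
  -- takes place.
  rw [div_mul_eq_mul_div, le_div_iff₀ (gapMin_pos hsupp hμ hij), mul_comm]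
  exact h

theorem abs_coeff_sub_le (hsupp : ∀ j, (μ j).support.Infinite) (hμ : IsAngelesco μ)
    {n : Fin d → ℕ} {j : Fin d} {P Q : ℝ[X]} (hP : IsMonicTypeII μ (n + unitIndex j) P)
    (hQ : IsMonicTypeII μ n Q) :
    |(X * Q - P).coeff (indexLength n)| ≤ sSup ((fun x : ℝ => |x|) '' hullMax μ) := by
  classical
  obtain ⟨Z, hZ, -, hPZ⟩ := hP.exists_zeros hsupp hμ
  rw [← Finset.prod_biUnion (fun i _ k _ hik => Finset.disjoint_left.2 fun z hzi hzk =>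
    Set.disjoint_left.1 (hμ.disjoint_hull i k hik) (hZ i hzi) (hZ k hzk))] at hPZ
  have hcard := natDegree_prod_X_sub_C (Finset.univ.biUnion Z)
  rw [← hPZ, hP.2.2, indexLength_add_unitIndex] at hcard
  have hW := wronskian_eval_ne_zero hsupp hμ hP hQ
  rw [hPZ] at hW ⊢
  refine abs_coeff_X_mul_sub_prod_le hcard.symm hQ.2.1 hQ.2.2 hW fun z hz => ?_
  obtain ⟨i, -, hi⟩ := Finset.mem_biUnion.1 hz
  exact abs_le_sSup_abs_hullMax hμ (hZ i hi)

end Hulls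

/-! ### Weighted norms and the ratio bound -/

section Norms

variable {d : ℕ} {μ : Fin d → Measure ℝ}

/-- The sign of `∏_{i ≠ j} ∏_{z ∈ Z i} (x - z)` on `Δ_j` depends only on the cardinalities of
the `Z i ⊆ Δ_i`. -/
theorem exists_sign_prod_erase (hμ : IsAngelesco μ) (j : Fin d) (k : Fin d → ℕ) :
    ∃ s : ℝ, ∀ Z : Fin d → Finset ℝ, (∀ i, (Z i : Set ℝ) ⊆ hullSupp μ i) →
      (∀ i, i ≠ j → (Z i).card = k i) → ∀ x ∈ hullSupp μ j,
        s * ∏ i ∈ Finset.univ.erase j, ∏ z ∈ Z i, (x - z) =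
            ∏ i ∈ Finset.univ.erase j, ∏ z ∈ Z i, |x - z| ∧
          0 < ∏ i ∈ Finset.univ.erase j, ∏ z ∈ Z i, |x - z| := by
  have : ∀ i, ∃ s : ℝ, i ≠ j →
      (s = 1 ∨ s = -1) ∧ ∀ x ∈ hullSupp μ j, ∀ z ∈ hullSupp μ i, 0 < s * (x - z) := fun i => by
    by_cases h : i = j
    · exact ⟨0, fun h' => absurd h h'⟩
    · obtain ⟨s, hs⟩ := exists_sign_sub_hullSupp hμ h
      exact ⟨s, fun _ => hs⟩
  choose s hs using this
  refine ⟨∏ i ∈ Finset.univ.erase j, s i ^ k i, fun Z hZ hk x hx => ⟨?_, ?_⟩⟩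
  · rw [← Finset.prod_mul_distrib]
    refine Finset.prod_congr rfl fun i hi => ?_
    have hij := Finset.ne_of_mem_erase hi
    rw [← hk i hij, ← Finset.prod_const, ← Finset.prod_mul_distrib]
    refine Finset.prod_congr rfl fun z hz => ?_
    have h1 := (hs i hij).2 x hx z (hZ i hz)
    have h2 : |s i| = 1 := by rcases (hs i hij).1 with h | h <;> simp [h]
    rw [← abs_of_pos h1, abs_mul, h2, one_mul]
  · refine Finset.prod_pos fun i hi => Finset.prod_pos fun z hz => abs_pos.2 fun h => ?_
    have := (hs i (Finset.ne_of_mem_erase hi)).2 x hx z (hZ i hz)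
    rw [h, mul_zero] at this
    exact this.false

theorem integral_eval_C_mul (j : Fin d) (c : ℝ) (P : ℝ[X]) :
    ∫ x, (C c * P).eval x ∂(μ j) = c * ∫ x, P.eval x ∂(μ j) := by
  simp_rw [eval_mul, eval_C]
  exact integral_const_mul _ _

variable [∀ j, IsFiniteMeasure (μ j)]

theorem integral_eval_add (hμ : IsAngelesco μ) (j : Fin d) (P Q : ℝ[X]) :
    ∫ x, (P + Q).eval x ∂(μ j) = ∫ x, P.eval x ∂(μ j) + ∫ x, Q.eval x ∂(μ j) := by
  simp_rw [eval_add]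
  exact integral_add (integrable_eval_of_isCompact_hull _ (hμ.isCompact_convexHull j) P)
    (integrable_eval_of_isCompact_hull _ (hμ.isCompact_convexHull j) Q)

/-- `p` and `X ^ n j` differ by a polynomial of lower degree, to which `P` is orthogonal. -/
theorem integral_mul_eval_eq_momentFunctional (hμ : IsAngelesco μ) {n : Fin d → ℕ} {P p : ℝ[X]}
    (hP : IsMonicTypeII μ n P) {j : Fin d} (hp : p.Monic) (hpn : p.natDegree = n j) :
    ∫ x, (P * p).eval x ∂(μ j) =
      momentFunctional (μ j) (hμ.isCompact_convexHull j) (n j) P := by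
  have hdeg : (p - X ^ n j).degree < (n j : WithBot ℕ) := by
    have h := degree_sub_lt_left (p := p) (q := X ^ n j)
      (by rw [degree_X_pow, degree_eq_natDegree hp.ne_zero, hpn]) hp.ne_zero
      (by rw [hp.leadingCoeff, (monic_X_pow _).leadingCoeff])
    rwa [degree_eq_natDegree hp.ne_zero, hpn] at h
  have h0 := integral_mul_eval_eq_zero (μ j) (hμ.isCompact_convexHull j) (hP.1.2 j) hdeg
  have h1 : P * p = P * (p - X ^ n j) + P * X ^ n j := by ring
  rw [h1, integral_eval_add hμ, h0, zero_add]
  refine integral_congr_ae (ae_of_all _ fun x => ?_)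
  simp

/-- Extremality of the factor `p` of `P = p q` whose weight `s q` is nonnegative on `Δ_j`. -/
theorem momentFunctional_mul_le_integral_sq (hμ : IsAngelesco μ) {n : Fin d → ℕ} {p q r : ℝ[X]}
    {j : Fin d} {s : ℝ} (hP : IsMonicTypeII μ n (p * q)) (hp : p.Monic) (hpn : p.natDegree = n j)
    (hr : r.Monic) (hrn : r.natDegree = n j)
    (hq : ∀ x ∈ hullSupp μ j, 0 ≤ s * q.eval x) :
    s * momentFunctional (μ j) (hμ.isCompact_convexHull j) (n j) (p * q) ≤
      ∫ x, (r ^ 2 * (C s * q)).eval x ∂(μ j) := by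
  have hdeg : (C (2 * s) * (r - p)).degree < (n j : WithBot ℕ) := by
    have h := degree_sub_lt_left (p := r) (q := p)
      (by rw [degree_eq_natDegree hr.ne_zero, degree_eq_natDegree hp.ne_zero, hpn, hrn])
      hr.ne_zero (by rw [hp.leadingCoeff, hr.leadingCoeff])
    rw [degree_eq_natDegree hr.ne_zero, hrn] at h
    rw [← smul_eq_C_mul]
    exact (degree_smul_le _ _).trans_lt h
  have h0 := integral_mul_eval_eq_zero (μ j) (hμ.isCompact_convexHull j) (hP.1.2 j) hdeg
  have h1 := integral_mul_eval_eq_momentFunctional hμ hP hp hpn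
  have h2 : ∫ x, (C s * (p * q * p) + p * q * (C (2 * s) * (r - p))).eval x ∂(μ j) =
      s * momentFunctional (μ j) (hμ.isCompact_convexHull j) (n j) (p * q) := by
    rw [integral_eval_add hμ, integral_eval_C_mul, h0, h1, add_zero]
  rw [← h2]
  refine integral_eval_le_of_le_on_hull _ (hμ.isCompact_convexHull j) fun x hx => ?_
  -- Pointwise `r² - p² - 2 p (r - p) = (r - p)²`, and the cross term has integral zero by
  -- orthogonality.
  have h3 := mul_nonneg (sq_nonneg (r.eval x - p.eval x)) (hq x hx)
  simp only [eval_add, eval_mul, eval_C, eval_sub, eval_pow]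
  linarith

theorem IsMonicTypeII.exists_factorization (hsupp : ∀ j, (μ j).support.Infinite)
    (hμ : IsAngelesco μ) {n : Fin d → ℕ} {P : ℝ[X]} (hP : IsMonicTypeII μ n P) (j : Fin d) :
    ∃ Z : Fin d → Finset ℝ, (∀ i, (Z i : Set ℝ) ⊆ hullSupp μ i) ∧ (∀ i, (Z i).card = n i) ∧
      P = (∏ z ∈ Z j, (X - C z)) * ∏ i ∈ Finset.univ.erase j, ∏ z ∈ Z i, (X - C z) ∧
      P = ∏ i, ∏ z ∈ Z i, (X - C z) := by
  obtain ⟨Z, hZ, hc, h⟩ := hP.exists_zeros hsupp hμ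
  exact ⟨Z, hZ, hc, h.trans (Finset.mul_prod_erase _ _ (Finset.mem_univ j)).symm, h⟩

theorem eval_prod_prod_X_sub_C (I : Finset (Fin d)) (Z : Fin d → Finset ℝ) (x : ℝ) :
    (∏ i ∈ I, ∏ z ∈ Z i, (X - C z) : ℝ[X]).eval x = ∏ i ∈ I, ∏ z ∈ Z i, (x - z) := by
  simp [eval_prod]

/-- The sign `s` depends only on the entries of the index off `j`, so it serves `n` and `n - e_j`
alike and cancels in their ratio. -/
theorem exists_sign_mul_momentFunctional_pos (hsupp : ∀ j, (μ j).support.Infinite)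
    (hμ : IsAngelesco μ) (j : Fin d) (k : Fin d → ℕ) :
    ∃ s : ℝ, ∀ (n : Fin d → ℕ) (P : ℝ[X]), IsMonicTypeII μ n P → (∀ i, i ≠ j → n i = k i) →
      0 < s * momentFunctional (μ j) (hμ.isCompact_convexHull j) (n j) P ∧
      ∀ (m : Fin d → ℕ) (Q : ℝ[X]), IsMonicTypeII μ m Q → m + unitIndex j = n →
        s * momentFunctional (μ j) (hμ.isCompact_convexHull j) (n j) P ≤
          (Metric.diam (hullMax μ) / gapMin μ) ^ (d - 1) * (Metric.diam (hullSupp μ j) / 2) ^ 2 *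
            (s * momentFunctional (μ j) (hμ.isCompact_convexHull j) (m j) Q) := by
  obtain ⟨s, hs⟩ := exists_sign_prod_erase hμ j k
  refine ⟨s, fun n P hP hnk => ?_⟩
  have hweight : ∀ Z : Fin d → Finset ℝ, (∀ i, (Z i : Set ℝ) ⊆ hullSupp μ i) →
      (∀ i, i ≠ j → (Z i).card = k i) → ∀ x ∈ hullSupp μ j,
        s * (∏ i ∈ Finset.univ.erase j, ∏ z ∈ Z i, (X - C z)).eval x =
            ∏ i ∈ Finset.univ.erase j, ∏ z ∈ Z i, |x - z| ∧
          0 < ∏ i ∈ Finset.univ.erase j, ∏ z ∈ Z i, |x - z| := fun Z hZ hk x hx => by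
    rw [eval_prod_prod_X_sub_C]
    exact hs Z hZ hk x hx
  have hnorm : ∀ (p q : ℝ[X]) (x : ℝ), (C s * (p * q * p)).eval x =
      p.eval x ^ 2 * (s * q.eval x) := fun p q x => by
    simp only [eval_mul, eval_C]; ring
  obtain ⟨Z, hZ, hc, hPj, hPp⟩ := hP.exists_factorization hsupp hμ j
  have hck : ∀ i, i ≠ j → (Z i).card = k i := fun i hi => (hc i).trans (hnk i hi)
  set p : ℝ[X] := ∏ z ∈ Z j, (X - C z) with hp
  set q : ℝ[X] := ∏ i ∈ Finset.univ.erase j, ∏ z ∈ Z i, (X - C z) with hq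
  have hpm : p.Monic := monic_prod_X_sub_C_finset _
  have hpn : p.natDegree = n j := (natDegree_prod_X_sub_C _).trans (hc j)
  have hqx : ∀ x ∈ hullSupp μ j,
      s * q.eval x = ∏ i ∈ Finset.univ.erase j, ∏ z ∈ Z i, |x - z| ∧
        0 < ∏ i ∈ Finset.univ.erase j, ∏ z ∈ Z i, |x - z| := hweight Z hZ hck
  constructor
  · rw [← integral_mul_eval_eq_momentFunctional hμ hP hpm hpn, ← integral_eval_C_mul, hPj]
    refine integral_eval_pos_of_nonneg_on_hull _ (hμ.isCompact_convexHull j) (hsupp j) ?_ ?_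
    · rw [← hPj]
      refine mul_ne_zero (fun h => ?_) (mul_ne_zero hP.2.1.ne_zero hpm.ne_zero)
      obtain ⟨x, hx⟩ := hullSupp_nonempty hsupp j
      have := hqx x hx
      rw [C_eq_zero.1 h, zero_mul] at this
      exact this.2.ne this.1
    · intro x hx
      rw [hnorm, (hqx x hx).1]
      exact mul_nonneg (sq_nonneg _) (hqx x hx).2.le
  · intro m Q hQ hmn
    obtain ⟨W, hW, hcW, hQj, hQp⟩ := hQ.exists_factorization hsupp hμ j
    have hnm : ∀ i, i ≠ j → m i = n i := fun i hi => by
      rw [← hmn]; simp [unitIndex, Pi.single_eq_of_ne hi]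
    have hnj : n j = m j + 1 := by rw [← hmn]; simp [unitIndex]
    have hcWk : ∀ i, i ≠ j → (W i).card = k i := fun i hi =>
      (hcW i).trans ((hnm i hi).trans (hnk i hi))
    have hqW := hweight W hW hcWk
    set p' : ℝ[X] := ∏ z ∈ W j, (X - C z) with hp'
    set q' : ℝ[X] := ∏ i ∈ Finset.univ.erase j, ∏ z ∈ W i, (X - C z) with hq'
    have hpm' : p'.Monic := monic_prod_X_sub_C_finset _
    have hpn' : p'.natDegree = m j := (natDegree_prod_X_sub_C _).trans (hcW j)
    obtain ⟨c, hcen⟩ := exists_center_hullSupp hμ j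
    -- The competitor is `(X - c) * p'`: its extra factor is at most half the length of the segment,
    -- the origin of `(|Δ_j| / 2)²`.
    have hle := momentFunctional_mul_le_integral_sq hμ (hPj ▸ hP) hpm hpn
      ((monic_X_sub_C c).mul hpm')
      (by rw [(monic_X_sub_C c).natDegree_mul hpm', natDegree_X_sub_C, hpn', hnj, add_comm])
      (fun x hx => by rw [(hqx x hx).1]; exact (hqx x hx).2.le)
    rw [← hPj] at hle
    refine hle.trans ?_
    rw [← integral_mul_eval_eq_momentFunctional hμ hQ hpm' hpn', ← integral_eval_C_mul,
      ← integral_eval_C_mul, hQj]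
    refine integral_eval_le_of_le_on_hull _ (hμ.isCompact_convexHull j) fun x hx => ?_
    have hratio := prod_prod_abs_le hsupp hμ hZ hW
      (fun i hi => (hc i).trans ((hnm i hi).symm.trans (hcW i).symm)) (hPp ▸ hmn.symm ▸ hP)
      (hQp ▸ hQ) hx
    have hleft : (((X - C c) * p') ^ 2 * (C s * q)).eval x =
        (x - c) ^ 2 * (p'.eval x ^ 2 * (s * q.eval x)) := by
      simp only [eval_mul, eval_pow, eval_sub, eval_X, eval_C]
      ring
    rw [hleft, (hqx x hx).1, eval_mul, eval_C, hnorm, (hqW x hx).1]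
    have hxc : (x - c) ^ 2 ≤ (Metric.diam (hullSupp μ j) / 2) ^ 2 := by
      rw [← sq_abs]
      exact pow_le_pow_left₀ (abs_nonneg _) (hcen x hx) 2
    calc (x - c) ^ 2 * (eval x p' ^ 2 * ∏ i ∈ Finset.univ.erase j, ∏ z ∈ Z i, |x - z|)
      _ ≤ (Metric.diam (hullSupp μ j) / 2) ^ 2 * (eval x p' ^ 2 *
          ((Metric.diam (hullMax μ) / gapMin μ) ^ (d - 1) *
            ∏ i ∈ Finset.univ.erase j, ∏ z ∈ W i, |x - z|)) :=
        mul_le_mul hxc (mul_le_mul_of_nonneg_left hratio (sq_nonneg _))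
          (mul_nonneg (sq_nonneg _) (hqx x hx).2.le) (sq_nonneg _)
      _ = _ := by ring

end Norms

/-! ### The theorem -/

theorem theorem4p1 {d : ℕ} (hd : 1 ≤ d) (μ : Fin d → Measure ℝ) [∀ j, IsFiniteMeasure (μ j)]
    (hsupp : ∀ j, (μ j).support.Infinite) (hμ : IsAngelesco μ) :
    IsPerfect μ ∧
    ∃ a b : (Fin d → ℕ) → Fin d → ℝ,
      IsRecurrenceCoeff μ a b ∧
      (∀ a' b' : (Fin d → ℕ) → Fin d → ℝ, IsRecurrenceCoeff μ a' b' → a' = a ∧ b' = b) ∧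
      (∀ n j, 0 < n j → 0 < a n j) ∧
      BddAbove (Set.range fun p : (Fin d → ℕ) × Fin d => a p.1 p.2) ∧
      BddAbove (Set.range fun p : (Fin d → ℕ) × Fin d => |b p.1 p.2|) ∧
      (∀ n j, a n j ≤
        (Metric.diam (hullMax μ) / gapMin μ) ^ (d - 1) * (Metric.diam (hullSupp μ j) / 2) ^ 2) ∧
      (∀ n j, |b n j| ≤ 7 * sSup ((fun x : ℝ => |x|) '' hullMax μ)) := by
  refine ⟨isPerfect_of_isAngelesco hsupp hμ, ?_⟩
  choose P hP using exists_isMonicTypeII hsupp hμ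
  have hnorm : ∀ n j, ∃ s : ℝ,
      0 < s * momentFunctional (μ j) (hμ.isCompact_convexHull j) (n j) (P n) ∧
      (0 < n j → 0 < s * momentFunctional (μ j) (hμ.isCompact_convexHull j) (n j - 1)
          (P (n - unitIndex j)) ∧
        s * momentFunctional (μ j) (hμ.isCompact_convexHull j) (n j) (P n) ≤
          (Metric.diam (hullMax μ) / gapMin μ) ^ (d - 1) * (Metric.diam (hullSupp μ j) / 2) ^ 2 *
            (s * momentFunctional (μ j) (hμ.isCompact_convexHull j) (n j - 1)
              (P (n - unitIndex j)))) := fun n j => by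
    obtain ⟨s, hs⟩ := exists_sign_mul_momentFunctional_pos hsupp hμ j n
    have h := hs n (P n) (hP n) fun _ _ => rfl
    refine ⟨s, h.1, fun hj => ?_⟩
    have hnj : (n - unitIndex j) j = n j - 1 := by simp [unitIndex]
    have h' := hs (n - unitIndex j) (P (n - unitIndex j)) (hP _) fun i hi => by
      simp [unitIndex, Pi.single_eq_of_ne hi]
    have h'' := h.2 _ _ (hP _) (sub_unitIndex_add_unitIndex hj)
    rw [hnj] at h' h''
    exact ⟨h'.1, h''⟩
  have hne : ∀ n j, momentFunctional (μ j) (hμ.isCompact_convexHull j) (n j) (P n) ≠ 0 :=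
    fun n j h0 => by
      obtain ⟨s, hs, -⟩ := hnorm n j
      rw [h0, mul_zero] at hs
      exact hs.false
  obtain ⟨a, b, ha, hrec⟩ := exists_recurrence_coeff hsupp hμ hP hne
  have hchar := recurrence_coeff_characterization hμ hP ha hrec
  have hK : 0 ≤ (Metric.diam (hullMax μ) / gapMin μ) ^ (d - 1) :=
    pow_nonneg (div_nonneg Metric.diam_nonneg gapMin_nonneg) _
  have habound : ∀ n j, a n j ≤
      (Metric.diam (hullMax μ) / gapMin μ) ^ (d - 1) * (Metric.diam (hullSupp μ j) / 2) ^ 2 := by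
    intro n j
    rcases (n j).eq_zero_or_pos with h0 | hj
    · rw [ha n j h0]; exact mul_nonneg hK (sq_nonneg _)
    · obtain ⟨s, -, hs⟩ := hnorm n j
      obtain ⟨hpos, hle⟩ := hs hj
      rw [(hchar n j).2 hj, mul_left_comm] at hle
      exact le_of_mul_le_mul_right hle hpos
  have hbbound : ∀ n j, |b n j| ≤ 7 * sSup ((fun x : ℝ => |x|) '' hullMax μ) := by
    intro n j
    have h := abs_coeff_sub_le hsupp hμ (hP (n + unitIndex j)) (hP n)
    rw [← (hchar n j).1] at h
    -- The convex-combination argument gives the constant `1`; as the supremum is nonnegative, `7`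
    -- follows.
    linarith [abs_nonneg (b n j)]
  refine ⟨a, b, ⟨P, hP, ha, hrec⟩, ?_, ?_, ?_, ⟨7 * sSup ((fun x : ℝ => |x|) '' hullMax μ), ?_⟩,
    habound, hbbound⟩
  · rintro a' b' ⟨P', hP', ha', hrec'⟩
    obtain rfl : P' = P := funext fun n => (hP' n).unique hsupp hμ (hP n)
    have hchar' := recurrence_coeff_characterization hμ hP ha' hrec'
    refine ⟨funext fun n => funext fun j => ?_, funext fun n => funext fun j => ?_⟩
    · rcases (n j).eq_zero_or_pos with h0 | hj
      · rw [ha n j h0, ha' n j h0]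
      · obtain ⟨s, -, hs⟩ := hnorm n j
        exact mul_right_cancel₀ (right_ne_zero_of_mul (hs hj).1.ne')
          (((hchar' n j).2 hj).symm.trans ((hchar n j).2 hj))
    · rw [(hchar' n j).1, (hchar n j).1]
  · intro n j hj
    obtain ⟨s, hpos, hs⟩ := hnorm n j
    rw [(hchar n j).2 hj, mul_left_comm] at hpos
    exact (pos_iff_pos_of_mul_pos hpos).2 (hs hj).1
  -- Replacing `Δ_j` by `Δ_max` makes the bound independent of `j`.
  · refine ⟨(Metric.diam (hullMax μ) / gapMin μ) ^ (d - 1) *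
      (Metric.diam (hullMax μ) / 2) ^ 2, ?_⟩
    rintro _ ⟨⟨n, j⟩, rfl⟩
    refine (habound n j).trans (mul_le_mul_of_nonneg_left ?_ hK)
    refine pow_le_pow_left₀ (by have := Metric.diam_nonneg (s := hullSupp μ j); positivity) ?_ 2
    have := Metric.diam_mono (hullSupp_subset_hullMax (μ := μ) j) (isBounded_hullMax hμ)
    linarith
  · rintro _ ⟨⟨n, j⟩, rfl⟩
    exact hbbound n j
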